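/- Setting. Let $B=(B(i,j))_{i,j\in\mathbb N}$ be a matrix with entries in $\{0,1\}$ and no zero row and no zero column, let $\Sigma=\{(x_1,x_2,\dots)\in\mathbb N^{\mathbb N}: B(x_n,x_{n+1})=1 \text{ for all } n\}$ be the associated one-sided countable Markov shift with shift map $\sigma$ and metric $d(x,y)=2^{-k}$, where $k\ge 0$ is the number of initial coordinates on which $x\neq y$ agree. A cylinder is a set $[a_1\dots a_n]=\{x\in\Sigma: x_j=a_j,\ 1\le j\le n\}$ with $n\ge 1$. The class $\mathcal R$ consists of the positive functions $\tau:\Sigma\to\mathbb R$ that are uniformly continuous and bounded away from zero, that satisfy $\sup\{|\tau(x)-\tau(y)| : d(x,y)\le 2^{-2}\}<\infty$, and for which $\lim_{k\to\infty}\inf\{\tau(x): x_1\ge k\}=\infty$. For $\tau\in\mathcal R$ let $Y$ be the quotient of $\{(x,t)\in\Sigma\times\mathbb R: 0\le t\le\tau(x)\}$ by the identifications $(x,\tau(x))\sim(\sigma(x),0)$, with its Borel $\sigma$-algebra, and let $(\theta_t)_{t\ge 0}$ be the suspension semi-flow on $Y$, determined by $\theta_t(x,s)=(x,s+t)$ whenever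 $s+t\in[0,\tau(x)]$ and $\theta_{t+r}=\theta_t\circ\theta_r$. Let $\mathcal M_{\le 1}(\Sigma,\sigma,\tau)$ be the set of Borel measures $\nu$ on $Y$ with $\nu(Y)\le 1$ that are invariant under every $\theta_t$. Fix $c$ with $0<c<\inf\tau$. A sequence $(\nu_n)_n$ of such measures converges on cylinders to $\nu$ if $\lim_{n\to\infty}\nu_n(C\times[0,c])=\nu(C\times[0,c])$ for every cylinder $C\subset\Sigma$; the topology of convergence on cylinders on $\mathcal M_{\le 1}(\Sigma,\sigma,\tau)$ is the coarsest topology that makes $\nu\mapsto\nu(C\times[0,c])$ continuous for every cylinder $C$. Theorem. Let $\tau\in\mathcal R$ and $0<c<\inf\tau$. Every sequence $(\nu_n)_n$ of invariant probability measures of the suspension semi-flow has a subsequence that converges on cylinders to some $\nu\in\mathcal M_{\le 1}(\Sigma,\sigma,\tau)$. Moreover, $\mathcal M_{\le 1}(\Sigma,\sigma,\tau)$ with the topology of convergence on cylinders is sequentially compact. -/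

import Mathlib

open Filter Topology MeasureTheory
open scoped NNReal ENNReal

/-- A transition matrix on the alphabet `ℕ`: entries `0` and `1`, no zero row, no zero column.
It is the datum that defines a one-sided countable Markov shift. -/
structure CountableMarkovShift where
  B : ℕ → ℕ → ℕ
  zero_or_one : ∀ i j, B i j = 0 ∨ B i j = 1
  row_ne_zero : ∀ i, ∃ j, B i j ≠ 0
  col_ne_zero : ∀ j, ∃ i, B i j ≠ 0

namespace CountableMarkovShift

/-- The phase space `Σ` (coordinates are indexed from `0`). -/
@[ext]
structure Shift (M : CountableMarkovShift) where
  val : ℕ → ℕ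
  admissible : ∀ n, M.B (val n) (val (n + 1)) = 1

variable {M : CountableMarkovShift}

/-- The metric `d(x,y) = 2^{-k}`, where `k` is the first index at which `x` and `y` differ,
and `d(x,x) = 0`. -/
noncomputable instance : MetricSpace M.Shift :=
  MetricSpace.induced Shift.val (fun _ _ h => Shift.ext h) PiNat.metricSpaceNatNat

theorem dist_le_iff (x y : M.Shift) (n : ℕ) :
    dist x y ≤ (1 / 2 : ℝ) ^ n ↔ ∀ i < n, x.val i = y.val i := by
  have e : dist x y = PiNat.dist.dist y.val x.val := PiNat.dist_comm x.val y.val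
  rw [e, ← PiNat.mem_cylinder_iff_dist_le]
  exact ⟨fun h i hi => (h i hi).symm, fun h i hi => (h i hi).symm⟩

noncomputable instance : MeasurableSpace M.Shift := borel _

instance : BorelSpace M.Shift := ⟨rfl⟩

/-- The shift map `σ`. -/
def shiftMap (x : M.Shift) : M.Shift := ⟨fun n => x.val (n + 1), fun n => x.admissible (n + 1)⟩

/-- The cylinder `[a₀ … aₙ]`, of length `n + 1 ≥ 1`. -/
def cylinder (M : CountableMarkovShift) {n : ℕ} (a : Fin (n + 1) → ℕ) : Set M.Shift :=
  {x | ∀ j : Fin (n + 1), x.val j = a j}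

/-- The variation `var_n(φ)`, the supremum of `|φ(x) - φ(y)|` over `d(x,y) ≤ 2^{-n}`,
as an element of `[0,∞]`. -/
noncomputable def variation (n : ℕ) (φ : M.Shift → ℝ) : ℝ≥0∞ :=
  ⨆ (x : M.Shift) (y : M.Shift) (_ : dist x y ≤ (1 / 2 : ℝ) ^ n), ENNReal.ofReal |φ x - φ y|

/-- The class `𝓡` of roof functions. -/
structure ClassR (τ : M.Shift → ℝ) : Prop where
  pos : ∀ x, 0 < τ x
  uniformContinuous : UniformContinuous τ
  bounded_away : ∃ c : ℝ, 0 < c ∧ ∀ x, c ≤ τ x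
  variation_two : variation 2 τ < ⊤
  tendsto_iInf : Tendsto (fun k : ℕ => ⨅ x : {x : M.Shift // k ≤ x.val 0}, τ x) atTop atTop

end CountableMarkovShift

open CountableMarkovShift

/-- A roof function: continuous, positive and bounded away from zero. -/
structure RoofFunction (M : CountableMarkovShift) where
  toFun : M.Shift → ℝ
  continuous_toFun : Continuous toFun
  bounded_away : ∃ c : ℝ, 0 < c ∧ ∀ x, c ≤ toFun x

namespace RoofFunction

variable {M : CountableMarkovShift}

instance : CoeFun (RoofFunction M) (fun _ => M.Shift → ℝ) := ⟨toFun⟩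

theorem pos (τ : RoofFunction M) (x : M.Shift) : 0 < τ x := by
  obtain ⟨c, hc, h⟩ := τ.bounded_away
  exact hc.trans_le (h x)

/-- The set of `(x,t)` with `0 ≤ t ≤ τ(x)`, before identification. -/
abbrev PreSpace (τ : RoofFunction M) : Type :=
  {p : M.Shift × ℝ // 0 ≤ p.2 ∧ p.2 ≤ τ p.1}

/-- The identifications: `(x, τ(x))` is glued to `(σ(x), 0)`. -/
def Glue (τ : RoofFunction M) (p q : τ.PreSpace) : Prop :=
  p.1.2 = τ p.1.1 ∧ q.1 = (shiftMap p.1.1, 0)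

/-- The suspension space `Y`, with the quotient topology and its Borel sets. -/
def Space (τ : RoofFunction M) : Type := Quot τ.Glue

instance (τ : RoofFunction M) : TopologicalSpace τ.Space :=
  inferInstanceAs (TopologicalSpace (Quot τ.Glue))

instance (τ : RoofFunction M) : MeasurableSpace τ.Space := borel _

instance (τ : RoofFunction M) : BorelSpace τ.Space := ⟨rfl⟩

/-- The class in `Y` of a point `(x,s)` with `0 ≤ s ≤ τ(x)`. -/
def point (τ : RoofFunction M) (x : M.Shift) (s : ℝ) (hs : 0 ≤ s ∧ s ≤ τ x) : τ.Space :=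
  Quot.mk τ.Glue ⟨(x, s), hs⟩

theorem exists_lt_birkhoffSum (τ : RoofFunction M) (x : M.Shift) (u : ℝ) :
    ∃ n : ℕ, u < birkhoffSum shiftMap τ (n + 1) x := by
  obtain ⟨c, hc, h⟩ := τ.bounded_away
  obtain ⟨n, hn⟩ := exists_nat_gt (u / c)
  refine ⟨n, ?_⟩
  have h1 : u < n * c := (div_lt_iff₀ hc).1 hn
  have h2 : ((n + 1 : ℕ) : ℝ) * c ≤ birkhoffSum shiftMap τ (n + 1) x := by
    unfold birkhoffSum
    calc ((n + 1 : ℕ) : ℝ) * c = ∑ _k ∈ Finset.range (n + 1), c := by simp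
      _ ≤ _ := Finset.sum_le_sum fun k _ => h _
  push_cast at h2
  linarith

open Classical in
/-- The number of returns to the base before time `u`, starting at `(x,0)`: the `n` with
`S_n τ(x) ≤ u < S_{n+1} τ(x)`, where `S_n τ` is the Birkhoff sum. -/
noncomputable def lap (τ : RoofFunction M) (x : M.Shift) (u : ℝ) : ℕ :=
  Nat.find (τ.exists_lt_birkhoffSum x u)

theorem lt_birkhoffSum_lap (τ : RoofFunction M) (x : M.Shift) (u : ℝ) :
    u < birkhoffSum shiftMap τ (τ.lap x u + 1) x := by
  classical
  exact Nat.find_spec (τ.exists_lt_birkhoffSum x u)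

theorem birkhoffSum_lap_le (τ : RoofFunction M) (x : M.Shift) {u : ℝ} (hu : 0 ≤ u) :
    birkhoffSum shiftMap τ (τ.lap x u) x ≤ u := by
  classical
  rcases Nat.eq_zero_or_eq_succ_pred (τ.lap x u) with h | h
  · rw [h]; simpa using hu
  · have h1 : (τ.lap x u).pred < τ.lap x u := by omega
    have h2 := Nat.find_min (τ.exists_lt_birkhoffSum x u) h1
    rw [not_lt] at h2
    rw [h]
    exact h2

theorem birkhoffSum_mono (τ : RoofFunction M) (x : M.Shift) :
    Monotone fun n => birkhoffSum shiftMap τ n x := by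
  refine monotone_nat_of_le_succ fun n => ?_
  simp only [birkhoffSum_succ]
  linarith [τ.pos (shiftMap^[n] x)]

theorem lap_eq (τ : RoofFunction M) (x : M.Shift) {u : ℝ} {n : ℕ}
    (h1 : birkhoffSum shiftMap τ n x ≤ u) (h2 : u < birkhoffSum shiftMap τ (n + 1) x) :
    τ.lap x u = n := by
  classical
  refine (Nat.find_eq_iff _).2 ⟨h2, fun k hk => not_lt.2 ?_⟩
  exact (τ.birkhoffSum_mono x hk).trans h1

/-- The point of `Y` reached at time `u ≥ 0` from the base point `(x,0)`, namely
`(σⁿ(x), u - S_n τ(x))` with `S_n τ(x) ≤ u < S_{n+1} τ(x)`. -/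
noncomputable def orbit (τ : RoofFunction M) (x : M.Shift) (u : ℝ) (hu : 0 ≤ u) : τ.Space :=
  τ.point (shiftMap^[τ.lap x u] x) (u - birkhoffSum shiftMap τ (τ.lap x u) x)
    ⟨sub_nonneg.2 (τ.birkhoffSum_lap_le x hu), by
      have h := τ.lt_birkhoffSum_lap x u
      rw [birkhoffSum_succ] at h
      linarith⟩

theorem orbit_glue (τ : RoofFunction M) (x : M.Shift) (t : ℝ) (ht : 0 ≤ t)
    (h : 0 ≤ τ x + t) : τ.orbit x (τ x + t) h = τ.orbit (shiftMap x) t ht := by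
  have hlap : τ.lap x (τ x + t) = τ.lap (shiftMap x) t + 1 := by
    apply τ.lap_eq
    · rw [birkhoffSum_succ']
      linarith [τ.birkhoffSum_lap_le (shiftMap x) ht]
    · rw [birkhoffSum_succ']
      linarith [τ.lt_birkhoffSum_lap (shiftMap x) t]
  unfold orbit point
  congr 1
  refine Subtype.ext (Prod.ext ?_ ?_)
  · simp only [hlap, Function.iterate_succ_apply]
  · simp only [hlap, birkhoffSum_succ']
    ring

/-- The suspension semi-flow `θ_t`, `t ≥ 0`: the point `(x,s)` is moved to the point reached from
`(x,0)` at time `s + t`. -/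
noncomputable def flow (τ : RoofFunction M) (t : ℝ≥0) : τ.Space → τ.Space :=
  Quot.lift (fun p : τ.PreSpace => τ.orbit p.1.1 (p.1.2 + t) (add_nonneg p.2.1 t.coe_nonneg)) (by
    rintro ⟨⟨x, s⟩, hs⟩ ⟨⟨y, r⟩, hr⟩ ⟨h1, h2⟩
    obtain ⟨rfl, rfl⟩ := Prod.mk.inj h2
    simp only at h1
    subst h1
    simp only [zero_add]
    exact τ.orbit_glue x t t.coe_nonneg _)

/-- `θ_t(x,s) = (x,s+t)` whenever `s + t ∈ [0, τ(x)]`. -/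
theorem flow_point (τ : RoofFunction M) (x : M.Shift) (s : ℝ) (t : ℝ≥0) (hs : 0 ≤ s ∧ s ≤ τ x)
    (hst : 0 ≤ s + t ∧ s + t ≤ τ x) : τ.flow t (τ.point x s hs) = τ.point x (s + t) hst := by
  change τ.orbit x (s + t) hst.1 = _
  rcases hst.2.lt_or_eq with h | h
  · have hlap : τ.lap x (s + t) = 0 := τ.lap_eq x (by simpa using hst.1) (by simpa using h)
    unfold orbit point
    congr 1
    refine Subtype.ext (Prod.ext ?_ ?_)
    · simp only [hlap, Function.iterate_zero, id]
    · simp [hlap]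
  · have h0 := τ.orbit_glue x 0 le_rfl (by simpa using (τ.pos x).le)
    have hlap : τ.lap (shiftMap x) 0 = 0 :=
      τ.lap_eq _ (by simp) (by simpa using τ.pos _)
    have h1 : τ.orbit (shiftMap x) 0 le_rfl = τ.point (shiftMap x) 0 ⟨le_rfl, (τ.pos _).le⟩ := by
      unfold orbit point
      congr 1
      refine Subtype.ext (Prod.ext ?_ ?_)
      · simp only [hlap, Function.iterate_zero, id]
      · simp [hlap]
    have h2 : τ.point x (s + t) hst = τ.point (shiftMap x) 0 ⟨le_rfl, (τ.pos _).le⟩ :=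
      Quot.sound ⟨h, rfl⟩
    rw [h2, ← h1, ← h0]
    congr 1
    rw [h, add_zero]

/-- The semi-flow property. -/
theorem flow_add (τ : RoofFunction M) (t r : ℝ≥0) (y : τ.Space) :
    τ.flow (t + r) y = τ.flow t (τ.flow r y) := by
  have key : ∀ (n : ℕ) (x : M.Shift) (v : ℝ) (hv : 0 ≤ v)
      (h : 0 ≤ birkhoffSum shiftMap τ n x + v),
      τ.orbit x (birkhoffSum shiftMap τ n x + v) h = τ.orbit (shiftMap^[n] x) v hv := by
    intro n
    induction n with
    | zero => intro x v hv h; simp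
    | succ n ih =>
      intro x v hv h
      have hn : 0 ≤ birkhoffSum shiftMap τ n (shiftMap x) := by
        simpa using τ.birkhoffSum_mono (shiftMap x) (Nat.zero_le n)
      have h' : 0 ≤ birkhoffSum shiftMap τ n (shiftMap x) + v := add_nonneg hn hv
      rw [Function.iterate_succ_apply, ← ih (shiftMap x) v hv h',
        ← τ.orbit_glue x _ h' (add_nonneg (τ.pos x).le h')]
      congr 1
      rw [birkhoffSum_succ', add_assoc]
  induction y using Quot.ind with
  | mk p =>
    obtain ⟨⟨x, s⟩, hs⟩ := p
    have hu : 0 ≤ s + (r : ℝ) := add_nonneg hs.1 r.coe_nonneg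
    set n := τ.lap x (s + r) with hn
    have h0 : 0 ≤ s + (r : ℝ) - birkhoffSum shiftMap τ n x :=
      sub_nonneg.2 (τ.birkhoffSum_lap_le x hu)
    change τ.orbit x (s + ((t + r : ℝ≥0) : ℝ)) (add_nonneg hs.1 (t + r).coe_nonneg) =
      τ.orbit (shiftMap^[n] x) (s + r - birkhoffSum shiftMap τ n x + t) (add_nonneg h0 t.coe_nonneg)
    have hS : 0 ≤ birkhoffSum shiftMap τ n x := by
      simpa using τ.birkhoffSum_mono x (Nat.zero_le n)
    refine Eq.trans ?_ (key n x _ (add_nonneg h0 t.coe_nonneg)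
      (add_nonneg hS (add_nonneg h0 t.coe_nonneg)))
    congr 1
    push_cast
    ring

/-- `ν` is invariant under the suspension semi-flow. -/
def Invariant (τ : RoofFunction M) (ν : Measure τ.Space) : Prop :=
  ∀ t : ℝ≥0, MeasurePreserving (τ.flow t) ν ν

/-- The space `𝓜_{≤1}(Σ,σ,τ)` of flow-invariant sub-probability measures on `Y`. -/
abbrev SubProb (τ : RoofFunction M) : Type :=
  {ν : Measure τ.Space // ν Set.univ ≤ 1 ∧ τ.Invariant ν}

/-- The subset `C × [0,c]` of `Y` (used with `c` smaller than the infimum of `τ`). -/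
def box (τ : RoofFunction M) (C : Set M.Shift) (c : ℝ) : Set τ.Space :=
  {y | ∃ (x : M.Shift) (s : ℝ) (hs : 0 ≤ s ∧ s ≤ τ x), x ∈ C ∧ s ≤ c ∧ y = τ.point x s hs}

/-- Convergence on cylinders: `ν_n(C × [0,c]) → ν(C × [0,c])` for every cylinder `C`. -/
def ConvergesOnCylinders (τ : RoofFunction M) (c : ℝ) (ν : ℕ → Measure τ.Space)
    (ν' : Measure τ.Space) : Prop :=
  ∀ (n : ℕ) (a : Fin (n + 1) → ℕ),
    Tendsto (fun k => ν k (τ.box (M.cylinder a) c)) atTop (𝓝 (ν' (τ.box (M.cylinder a) c)))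

/-- The topology of convergence on cylinders on `𝓜_{≤1}(Σ,σ,τ)`: the coarsest topology for which
`ν ↦ ν(C × [0,c])` is continuous for every cylinder `C`. -/
abbrev cylinderTopology (τ : RoofFunction M) (c : ℝ) : TopologicalSpace τ.SubProb :=
  TopologicalSpace.induced
    (fun ν (w : Σ n : ℕ, Fin (n + 1) → ℕ) => ν.1 (τ.box (M.cylinder w.2) c)) inferInstance

theorem tendsto_cylinderTopology_iff (τ : RoofFunction M) (c : ℝ) (ν : ℕ → τ.SubProb)
    (ν' : τ.SubProb) :
    Tendsto ν atTop (@nhds _ (τ.cylinderTopology c) ν') ↔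
      τ.ConvergesOnCylinders c (fun k => (ν k).1) ν'.1 := by
  rw [cylinderTopology, nhds_induced, tendsto_comap_iff, tendsto_pi_nhds, Sigma.forall]
  rfl

end RoofFunction

/-! An invariant measure on `Y` of mass at most `1` is locally a product: below the graph of the
roof it equals `μ × Leb`, where `μ` is a finite shift-invariant measure on the base and `∫ τ dμ =
ν(Y) ≤ 1`. Conversely, every such `μ` lifts to an invariant measure of mass `∫ τ dμ`. Since `c < τ`
everywhere, `ν(C × [0,c]) = c · μ(C)`, so the theorem becomes a statement about the base measures
(`exists_baseInvariant_lift_eq`, `invariant_lift`, `lift_box`).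

These base measures form a weakly compact set (`isCompact_baseInvariant`). Because `τ` is large when
the first symbol is large, Markov's inequality makes large first symbols improbable, and
shift-invariance transfers the bound to every coordinate; this gives tightness. The set is closed
because `∫ τ dμ` is a supremum of integrals of bounded continuous functions. The limit satisfies
only `∫ τ dμ' ≤ 1`, so the lifted limit is a sub-probability. Cylinders are clopen, so their
measures are weakly continuous in `μ`. -/

namespace CountableMarkovShift

variable {M : CountableMarkovShift}

/-! ### Topology of the shift space. -/

/-- Admissibility is a closed condition on each pair of consecutive coordinates, so compact subsets
of the full shift pull back to compact subsets of `Σ`. -/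
theorem isClosedEmbedding_val : IsClosedEmbedding (Shift.val : M.Shift → ℕ → ℕ) := by
  refine ⟨⟨⟨rfl⟩, fun _ _ h => Shift.ext h⟩, ?_⟩
  have : Set.range (Shift.val : M.Shift → ℕ → ℕ) = ⋂ n, {u | M.B (u n) (u (n + 1)) = 1} := by
    ext u
    simp only [Set.mem_range, Set.mem_iInter, Set.mem_ofPred_eq]
    exact ⟨by rintro ⟨x, rfl⟩; exact x.admissible, fun h => ⟨⟨u, h⟩, rfl⟩⟩
  rw [this]
  refine isClosed_iInter fun n => ?_
  have h0 : Continuous fun p : ℕ × ℕ => M.B p.1 p.2 := continuous_of_discreteTopology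
  have h : Continuous fun u : ℕ → ℕ => M.B (u n) (u (n + 1)) :=
    h0.comp (f := fun u : ℕ → ℕ => (u n, u (n + 1)))
      ((continuous_apply n).prodMk (continuous_apply (n + 1)))
  exact isClosed_eq h continuous_const

instance : SecondCountableTopology M.Shift :=
  isClosedEmbedding_val.isEmbedding.secondCountableTopology

theorem continuous_coordinate (n : ℕ) : Continuous fun x : M.Shift => x.val n :=
  (continuous_apply n).comp isClosedEmbedding_val.continuous

theorem continuous_shiftMap : Continuous (shiftMap : M.Shift → M.Shift) := by
  rw [isClosedEmbedding_val.isInducing.continuous_iff]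
  exact continuous_pi fun n => continuous_coordinate (n + 1)

theorem isClopen_cylinder {n : ℕ} (a : Fin (n + 1) → ℕ) : IsClopen (M.cylinder a) := by
  have : M.cylinder a = ⋂ j : Fin (n + 1), (fun x : M.Shift => x.val j) ⁻¹' {a j} := by
    ext x; simp [cylinder]
  rw [this]
  exact isClopen_iInter_of_finite fun j =>
    (isClopen_discrete {a j}).preimage (continuous_coordinate (j : ℕ))

theorem shiftMap_iterate_val (n : ℕ) (x : M.Shift) (i : ℕ) :
    (shiftMap^[n] x).val i = x.val (i + n) := by
  induction n generalizing x with
  | zero => rfl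
  | succ n ih =>
    rw [Function.iterate_succ_apply, ih]
    change x.val (i + n + 1) = _
    rw [add_assoc]

/-- Infinite products of finite sets of symbols cut out compact sets of the shift. -/
theorem isCompact_setOf_val_lt (b : ℕ → ℕ) : IsCompact {x : M.Shift | ∀ j, x.val j < b j} := by
  have h : IsCompact (Set.univ.pi fun j => Set.Iio (b j)) :=
    isCompact_univ_pi fun j => (Set.finite_Iio (b j)).isCompact
  have e : {x : M.Shift | ∀ j, x.val j < b j} = Shift.val ⁻¹' Set.univ.pi fun j => Set.Iio (b j) := by
    ext x; simp
  rw [e]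
  exact isClosedEmbedding_val.isCompact_preimage h

end CountableMarkovShift

/-! ### Coordinates on the suspension space. -/

namespace RoofFunction

variable {M : CountableMarkovShift} (τ : RoofFunction M)

theorem measurable_toFun : Measurable τ := τ.continuous_toFun.measurable

/-- The region below the graph of the roof function, a fundamental domain for `Y`. -/
def region : Set (M.Shift × ℝ) := {p | 0 ≤ p.2 ∧ p.2 < τ p.1}

theorem measurableSet_region : MeasurableSet τ.region :=
  (measurableSet_le measurable_const measurable_snd).inter
    (measurableSet_lt measurable_snd (τ.measurable_toFun.comp measurable_fst))

/-- The point of `Y` over `(x,s)`, where `s` is first projected to `[0, τ(x)]`. -/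
def clampPoint (p : M.Shift × ℝ) : τ.Space :=
  τ.point p.1 (max 0 (min p.2 (τ p.1))) ⟨le_max_left _ _, max_le (τ.pos _).le (min_le_right _ _)⟩

theorem point_congr {x y : M.Shift} {s r : ℝ} (hs : 0 ≤ s ∧ s ≤ τ x) (hr : 0 ≤ r ∧ r ≤ τ y)
    (hxy : x = y) (hsr : s = r) : τ.point x s hs = τ.point y r hr := by
  subst hxy hsr; rfl

theorem clampPoint_eq {p : M.Shift × ℝ} (hp : 0 ≤ p.2 ∧ p.2 ≤ τ p.1) :
    τ.clampPoint p = τ.point p.1 p.2 hp :=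
  τ.point_congr _ _ rfl (by rw [min_eq_left hp.2, max_eq_right hp.1])

/-- The quotient map onto `Y`. -/
def proj (p : τ.PreSpace) : τ.Space := Quot.mk τ.Glue p

theorem isQuotientMap_proj : IsQuotientMap τ.proj :=
  isQuotientMap_quot_mk

theorem continuous_clampPoint : Continuous τ.clampPoint := by
  refine τ.isQuotientMap_proj.continuous.comp (Continuous.subtype_mk (continuous_fst.prodMk ?_) _)
  exact continuous_const.max (continuous_snd.min (τ.continuous_toFun.comp continuous_fst))

open Classical in
/-- The representative `(x,s)` with `0 ≤ s < τ(x)` of a point of `Y`. -/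
noncomputable def coord : τ.Space → M.Shift × ℝ :=
  Quot.lift (fun p : τ.PreSpace => if p.1.2 = τ p.1.1 then (shiftMap p.1.1, 0) else p.1) (by
    rintro p q ⟨h1, h2⟩
    have h3 : (0 : ℝ) ≠ τ (shiftMap p.1.1) := (τ.pos _).ne
    simp only [h1, h2, if_true, if_neg h3])

theorem coord_point_of_lt {x : M.Shift} {s : ℝ} (hs : 0 ≤ s ∧ s ≤ τ x) (h : s < τ x) :
    τ.coord (τ.point x s hs) = (x, s) :=
  if_neg h.ne

theorem coord_point_of_eq {x : M.Shift} {s : ℝ} (hs : 0 ≤ s ∧ s ≤ τ x) (h : s = τ x) :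
    τ.coord (τ.point x s hs) = (shiftMap x, 0) :=
  if_pos h

theorem coord_mem_region (y : τ.Space) : τ.coord y ∈ τ.region := by
  induction y using Quot.ind with
  | mk p =>
    obtain ⟨⟨x, s⟩, hs⟩ := p
    change τ.coord (τ.point x s hs) ∈ _
    rcases hs.2.lt_or_eq with h | h
    · rw [coord_point_of_lt τ hs h]; exact ⟨hs.1, h⟩
    · rw [coord_point_of_eq τ hs h]; exact ⟨le_rfl, τ.pos _⟩

theorem clampPoint_coord (y : τ.Space) : τ.clampPoint (τ.coord y) = y := by
  induction y using Quot.ind with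
  | mk p =>
    obtain ⟨⟨x, s⟩, hs⟩ := p
    change τ.clampPoint (τ.coord (τ.point x s hs)) = τ.point x s hs
    rcases hs.2.lt_or_eq with h | h
    · rw [coord_point_of_lt τ hs h, τ.clampPoint_eq hs]
    · rw [coord_point_of_eq τ hs h, τ.clampPoint_eq (p := (shiftMap x, 0)) ⟨le_rfl, (τ.pos _).le⟩]
      exact (Quot.sound ⟨h, rfl⟩).symm

theorem coord_clampPoint {p : M.Shift × ℝ} (hp : p ∈ τ.region) : τ.coord (τ.clampPoint p) = p := by
  rw [τ.clampPoint_eq ⟨hp.1, hp.2.le⟩, τ.coord_point_of_lt _ hp.2]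

theorem exists_eq_point (y : τ.Space) :
    ∃ (x : M.Shift) (s : ℝ) (hs : 0 ≤ s ∧ s < τ x), y = τ.point x s ⟨hs.1, hs.2.le⟩ := by
  have h := τ.coord_mem_region y
  refine ⟨(τ.coord y).1, (τ.coord y).2, h, ?_⟩
  rw [← τ.clampPoint_eq (p := τ.coord y), τ.clampPoint_coord]

/-- The set of points of `Y` of height `0` over a closed set is closed. -/
theorem isClosed_base {K : Set (M.Shift × ℝ)} (hK : IsClosed K) :
    IsClosed {y : τ.Space | (τ.coord y).2 = 0 ∧ τ.coord y ∈ K} := by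
  refine τ.isQuotientMap_proj.isClosed_preimage.1 ?_
  have hc : Continuous fun p : τ.PreSpace => p.1.1 := continuous_fst.comp continuous_subtype_val
  have hh : Continuous fun p : τ.PreSpace => p.1.2 := continuous_snd.comp continuous_subtype_val
  have e : τ.proj ⁻¹' {y : τ.Space | (τ.coord y).2 = 0 ∧ τ.coord y ∈ K} =
      ({p | p.1.2 = 0} ∩ {p | p.1 ∈ K}) ∪
        ({p | p.1.2 = τ p.1.1} ∩ {p | (shiftMap p.1.1, (0 : ℝ)) ∈ K}) := by
    ext ⟨⟨x, s⟩, hs⟩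
    change ((τ.coord (τ.point x s hs)).2 = 0 ∧ τ.coord (τ.point x s hs) ∈ K) ↔
      ((s = 0 ∧ (x, s) ∈ K) ∨ (s = τ x ∧ (shiftMap x, (0 : ℝ)) ∈ K))
    rcases hs.2.lt_or_eq with h | h
    · rw [coord_point_of_lt τ hs h]; simp [h.ne]
    · rw [coord_point_of_eq τ hs h]
      replace h : s = τ x := h
      have h0 : s ≠ 0 := h ▸ (τ.pos x).ne'
      simp [h0, ← h]
  rw [e]
  refine IsClosed.union (IsClosed.inter (isClosed_eq hh continuous_const)
    (hK.preimage continuous_subtype_val)) (IsClosed.inter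
      (isClosed_eq hh (τ.continuous_toFun.comp hc)) ?_)
  exact hK.preimage ((continuous_shiftMap.comp hc).prodMk continuous_const)

/-- Adjoining the whole base makes the set saturated: upstairs it is the bottom, the entire roof and
`K`, all closed. -/
theorem isClosed_base_union {K : Set (M.Shift × ℝ)} (hK : IsClosed K) :
    IsClosed {y : τ.Space | (τ.coord y).2 = 0 ∨ τ.coord y ∈ K} := by
  refine τ.isQuotientMap_proj.isClosed_preimage.1 ?_
  have hc : Continuous fun p : τ.PreSpace => p.1.1 := continuous_fst.comp continuous_subtype_val
  have hh : Continuous fun p : τ.PreSpace => p.1.2 := continuous_snd.comp continuous_subtype_val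
  have e : τ.proj ⁻¹' {y : τ.Space | (τ.coord y).2 = 0 ∨ τ.coord y ∈ K} =
      ({p | p.1.2 = 0} ∪ {p | p.1.2 = τ p.1.1}) ∪ {p | p.1 ∈ K} := by
    ext ⟨⟨x, s⟩, hs⟩
    change ((τ.coord (τ.point x s hs)).2 = 0 ∨ τ.coord (τ.point x s hs) ∈ K) ↔
      ((s = 0 ∨ s = τ x) ∨ (x, s) ∈ K)
    rcases hs.2.lt_or_eq with h | h
    · rw [coord_point_of_lt τ hs h]; simp [h.ne]
    · rw [coord_point_of_eq τ hs h]; simp [show s = τ x from h]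
  rw [e]
  exact ((isClosed_eq hh continuous_const).union (isClosed_eq hh (τ.continuous_toFun.comp hc))).union
    (hK.preimage continuous_subtype_val)

/-- `coord` jumps at the glued roof, so it need not be continuous. The preimage of a closed set is
nevertheless a Boolean combination of closed sets, once the points of height `0` are treated
separately. -/
theorem measurable_coord : Measurable τ.coord := by
  refine measurable_of_isClosed fun K hK => ?_
  have e : τ.coord ⁻¹' K = {y : τ.Space | (τ.coord y).2 = 0 ∧ τ.coord y ∈ K} ∪
      ({y : τ.Space | (τ.coord y).2 = 0 ∨ τ.coord y ∈ K} \
        {y : τ.Space | (τ.coord y).2 = 0 ∧ τ.coord y ∈ Set.univ}) := by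
    ext y
    simp only [Set.mem_preimage, Set.mem_union, Set.mem_sdiff, Set.mem_ofPred_eq, Set.mem_univ]
    tauto
  rw [e]
  exact (τ.isClosed_base hK).measurableSet.union
    ((τ.isClosed_base_union hK).measurableSet.diff (τ.isClosed_base isClosed_univ).measurableSet)

/-! ### The semi-flow in coordinates. -/

theorem coord_flow (t : ℝ≥0) (y : τ.Space) :
    ∃ n : ℕ, τ.coord (τ.flow t y) = (shiftMap^[n] (τ.coord y).1,
      (τ.coord y).2 + t - birkhoffSum shiftMap τ n (τ.coord y).1) ∧
      birkhoffSum shiftMap τ n (τ.coord y).1 ≤ (τ.coord y).2 + t ∧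
      (τ.coord y).2 + t < birkhoffSum shiftMap τ (n + 1) (τ.coord y).1 := by
  obtain ⟨x, s, hs, rfl⟩ := τ.exists_eq_point y
  rw [coord_point_of_lt τ _ hs.2]
  have hu : 0 ≤ s + (t : ℝ) := add_nonneg hs.1 t.coe_nonneg
  refine ⟨τ.lap x (s + t), ?_, τ.birkhoffSum_lap_le x hu, τ.lt_birkhoffSum_lap x _⟩
  change τ.coord (τ.orbit x (s + t) hu) = _
  refine τ.coord_point_of_lt _ ?_
  have h := τ.lt_birkhoffSum_lap x (s + t)
  rw [birkhoffSum_succ] at h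
  linarith

theorem coord_flow_of_lt {t : ℝ≥0} {y : τ.Space} (h : (τ.coord y).2 + t < τ (τ.coord y).1) :
    τ.coord (τ.flow t y) = ((τ.coord y).1, (τ.coord y).2 + t) := by
  obtain ⟨n, h1, h2, -⟩ := τ.coord_flow t y
  cases n with
  | zero => simpa using h1
  | succ n =>
    have := τ.birkhoffSum_mono (τ.coord y).1 (Nat.succ_le_succ (Nat.zero_le n))
    simp only [Nat.succ_eq_add_one, zero_add, birkhoffSum_one] at this
    linarith

/-- After crossing the roof, the height is smaller than the elapsed time. -/
theorem coord_flow_snd_lt_of_le {t : ℝ≥0} {y : τ.Space}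
    (h : τ (τ.coord y).1 ≤ (τ.coord y).2 + t) : (τ.coord (τ.flow t y)).2 < t := by
  obtain ⟨n, h1, -, h3⟩ := τ.coord_flow t y
  have h4 := (τ.coord_mem_region y).2
  cases n with
  | zero => simp only [zero_add, birkhoffSum_one] at h3; linarith
  | succ n =>
    have := τ.birkhoffSum_mono (τ.coord y).1 (Nat.succ_le_succ (Nat.zero_le n))
    simp only [Nat.succ_eq_add_one, zero_add, birkhoffSum_one] at this
    rw [h1]
    simp only
    linarith

/-- A second crossing would need `s + t ≥ τ(x) + τ(σx) > τ(x) + c`, while `s < τ(x)` and `t ≤ c`. -/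
theorem coord_flow_of_le {c : ℝ} (hc : ∀ x, c < τ x) {t : ℝ≥0} (ht : (t : ℝ) ≤ c) {y : τ.Space}
    (h : τ (τ.coord y).1 ≤ (τ.coord y).2 + t) :
    τ.coord (τ.flow t y) =
      (shiftMap (τ.coord y).1, (τ.coord y).2 + t - τ (τ.coord y).1) := by
  obtain ⟨n, h1, h2, h3⟩ := τ.coord_flow t y
  have h4 := (τ.coord_mem_region y).2
  match n with
  | 0 => simp only [zero_add, birkhoffSum_one] at h3; linarith
  | 1 => simpa using h1
  | n + 2 =>
    have := τ.birkhoffSum_mono (τ.coord y).1 (show 2 ≤ n + 2 by omega)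
    simp only [birkhoffSum_succ', birkhoffSum_zero'] at this
    have h5 := hc (shiftMap (τ.coord y).1)
    simp only [birkhoffSum_succ'] at h2
    have h6 : 0 ≤ birkhoffSum shiftMap τ n (shiftMap (shiftMap (τ.coord y).1)) := by
      simpa using τ.birkhoffSum_mono (shiftMap (shiftMap (τ.coord y).1)) (Nat.zero_le n)
    linarith

/-! ### Lifting base measures to `Y`. -/

/-- The restriction of `μ × Leb` to the region below the graph of `τ`. -/
noncomputable def graphMeasure (μ : Measure M.Shift) : Measure (M.Shift × ℝ) :=
  (μ.prod volume).restrict τ.region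

/-- The measure on `Y` induced by `μ × Leb`. -/
noncomputable def lift (μ : Measure M.Shift) : Measure τ.Space :=
  (τ.graphMeasure μ).map τ.clampPoint

theorem graphMeasure_apply (μ : Measure M.Shift) [SFinite μ] {E : Set (M.Shift × ℝ)}
    (hE : MeasurableSet E) :
    τ.graphMeasure μ E = ∫⁻ x, volume {s : ℝ | (x, s) ∈ E ∧ 0 ≤ s ∧ s < τ x} ∂μ := by
  rw [graphMeasure, Measure.restrict_apply hE,
    Measure.prod_apply (hE.inter τ.measurableSet_region)]
  rfl

theorem map_coord_lift (μ : Measure M.Shift) [SFinite μ] :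
    (τ.lift μ).map τ.coord = τ.graphMeasure μ := by
  rw [lift, Measure.map_map τ.measurable_coord τ.continuous_clampPoint.measurable]
  have h : τ.coord ∘ τ.clampPoint =ᵐ[τ.graphMeasure μ] id :=
    (ae_restrict_iff' τ.measurableSet_region).2 (ae_of_all _ fun p hp => τ.coord_clampPoint hp)
  rw [Measure.map_congr h, Measure.map_id]

theorem map_clampPoint_map_coord (ν : Measure τ.Space) :
    (ν.map τ.coord).map τ.clampPoint = ν := by
  rw [Measure.map_map τ.continuous_clampPoint.measurable τ.measurable_coord]
  have h : τ.clampPoint ∘ τ.coord = id := funext τ.clampPoint_coord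
  rw [h, Measure.map_id]

theorem lift_univ (μ : Measure M.Shift) [SFinite μ] :
    τ.lift μ Set.univ = ∫⁻ x, ENNReal.ofReal (τ x) ∂μ := by
  rw [lift, Measure.map_apply τ.continuous_clampPoint.measurable MeasurableSet.univ,
    Set.preimage_univ, τ.graphMeasure_apply μ MeasurableSet.univ]
  refine lintegral_congr fun x => ?_
  have : {s : ℝ | (x, s) ∈ (Set.univ : Set (M.Shift × ℝ)) ∧ 0 ≤ s ∧ s < τ x} =
      Set.Ico 0 (τ x) := by
    ext s; simp
  rw [this, Real.volume_Ico, sub_zero]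

/-- As `c < τ`, no point `(x,s)` with `s ≤ c` lies on the roof, so the box is not affected by the
gluing. -/
theorem box_eq_preimage {c : ℝ} (hc : ∀ x, c < τ x) (C : Set M.Shift) :
    τ.box C c = τ.coord ⁻¹' (C ×ˢ Set.Iic c) := by
  ext y
  constructor
  · rintro ⟨x, s, hs, hx, hsc, rfl⟩
    rw [Set.mem_preimage, τ.coord_point_of_lt hs (hsc.trans_lt (hc x))]
    exact ⟨hx, hsc⟩
  · intro h
    have h1 := τ.coord_mem_region y
    refine ⟨(τ.coord y).1, (τ.coord y).2, ⟨h1.1, h1.2.le⟩, h.1, h.2, ?_⟩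
    rw [← τ.clampPoint_eq (p := τ.coord y), τ.clampPoint_coord]

theorem lift_box (μ : Measure M.Shift) [SFinite μ] {c : ℝ} (hc : ∀ x, c < τ x)
    {C : Set M.Shift} (hC : MeasurableSet C) :
    τ.lift μ (τ.box C c) = ENNReal.ofReal c * μ C := by
  have hm : MeasurableSet (C ×ˢ Set.Iic c) := hC.prod measurableSet_Iic
  rw [τ.box_eq_preimage hc, ← Measure.map_apply τ.measurable_coord hm, τ.map_coord_lift,
    τ.graphMeasure_apply μ hm, ← lintegral_indicator_const hC]
  refine lintegral_congr fun x => ?_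
  by_cases hx : x ∈ C
  · rw [Set.indicator_of_mem hx]
    have : {s : ℝ | (x, s) ∈ C ×ˢ Set.Iic c ∧ 0 ≤ s ∧ s < τ x} = Set.Icc 0 c := by
      ext s
      simp only [Set.mem_prod, hx, true_and, Set.mem_Iic, Set.mem_ofPred_eq, Set.mem_Icc]
      exact ⟨fun h => ⟨h.2.1, h.1⟩, fun h => ⟨h.2, h.1, h.2.trans_lt (hc x)⟩⟩
    rw [this, Real.volume_Icc, sub_zero]
  · rw [Set.indicator_of_notMem hx]
    have : {s : ℝ | (x, s) ∈ C ×ˢ Set.Iic c ∧ 0 ≤ s ∧ s < τ x} = ∅ := by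
      ext s; simp [hx]
    rw [this, measure_empty]

open Classical in
/-- The flow for times below `inf τ`, in coordinates. -/
noncomputable def coordFlow (t : ℝ) (p : M.Shift × ℝ) : M.Shift × ℝ :=
  if p.2 + t < τ p.1 then (p.1, p.2 + t) else (shiftMap p.1, p.2 + t - τ p.1)

theorem measurable_coordFlow (t : ℝ) : Measurable (τ.coordFlow t) := by
  have h1 : Measurable fun p : M.Shift × ℝ => τ p.1 := τ.measurable_toFun.comp measurable_fst
  have h2 : Measurable fun p : M.Shift × ℝ => p.2 + t := measurable_snd.add_const t
  exact Measurable.ite (measurableSet_lt h2 h1) (measurable_fst.prodMk h2)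
    ((continuous_shiftMap.measurable.comp measurable_fst).prodMk (h2.sub h1))

theorem coord_flow_eq_coordFlow {c : ℝ} (hc : ∀ x, c < τ x) {t : ℝ≥0} (ht : (t : ℝ) ≤ c)
    (y : τ.Space) : τ.coord (τ.flow t y) = τ.coordFlow t (τ.coord y) := by
  by_cases h : (τ.coord y).2 + t < τ (τ.coord y).1
  · rw [τ.coord_flow_of_lt h, coordFlow, if_pos h]
  · rw [τ.coord_flow_of_le hc ht (not_lt.1 h), coordFlow, if_neg h]

theorem measurable_flow_of_le {c : ℝ} (hc : ∀ x, c < τ x) {t : ℝ≥0} (ht : (t : ℝ) ≤ c) :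
    Measurable (τ.flow t) := by
  have : τ.flow t = τ.clampPoint ∘ τ.coordFlow t ∘ τ.coord := by
    funext y
    rw [Function.comp_apply, Function.comp_apply, ← τ.coord_flow_eq_coordFlow hc ht,
      τ.clampPoint_coord]
  rw [this]
  exact τ.continuous_clampPoint.measurable.comp ((τ.measurable_coordFlow t).comp τ.measurable_coord)

/-- Cut each fibre at height `t`. Points that do not cross the roof are translated onto `[t, τ(x))`
over `x`; those that cross are translated onto `[0,t)` over `σ(x)`. Lebesgue measure is preserved in
both cases, and shift-invariance of `μ` replaces `low (shiftMap x)` by `low x` after integration. -/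
theorem measurePreserving_coordFlow {μ : Measure M.Shift} [SFinite μ]
    (hμ : MeasurePreserving shiftMap μ μ) {c : ℝ} (hc : ∀ x, c < τ x) {t : ℝ} (h0 : 0 ≤ t)
    (ht : t ≤ c) : MeasurePreserving (τ.coordFlow t) (τ.graphMeasure μ) (τ.graphMeasure μ) := by
  refine ⟨τ.measurable_coordFlow t, Measure.ext fun E hE => ?_⟩
  rw [Measure.map_apply (τ.measurable_coordFlow t) hE, τ.graphMeasure_apply μ hE,
    τ.graphMeasure_apply μ (τ.measurable_coordFlow t hE)]
  set low : M.Shift → ℝ≥0∞ := fun x => volume {s : ℝ | (x, s) ∈ E ∧ 0 ≤ s ∧ s < t}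
  set high : M.Shift → ℝ≥0∞ := fun x => volume {s : ℝ | (x, s) ∈ E ∧ t ≤ s ∧ s < τ x}
  have hlow : Measurable low := measurable_measure_prodMk_left
    (hE.inter ((measurableSet_le measurable_const measurable_snd).inter
      (measurableSet_lt measurable_snd measurable_const)))
  have hslice : ∀ x (a b : ℝ), MeasurableSet {s : ℝ | (x, s) ∈ E ∧ a ≤ s ∧ s < b} := fun x a b =>
    (measurable_prodMk_left hE).inter measurableSet_Ico
  have e1 : ∀ x, volume {s : ℝ | (x, s) ∈ E ∧ 0 ≤ s ∧ s < τ x} = low x + high x := fun x => by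
    rw [← measure_union _ (hslice x t (τ x))]
    · congr 1
      ext s
      have := hc x
      simp only [Set.mem_ofPred_eq, Set.mem_union]
      grind
    · rw [Set.disjoint_left]
      rintro s ⟨-, -, h1⟩ ⟨-, h2, -⟩
      exact absurd h2 (not_le.2 h1)
  have e2 : ∀ x, volume {s : ℝ | (x, s) ∈ τ.coordFlow t ⁻¹' E ∧ 0 ≤ s ∧ s < τ x} =
      low (shiftMap x) + high x := fun x => by
    have hA := measure_preimage_add_right volume t {s : ℝ | (x, s) ∈ E ∧ t ≤ s ∧ s < τ x}
    have hB := measure_preimage_add_right volume (t - τ x)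
      {s : ℝ | (shiftMap x, s) ∈ E ∧ 0 ≤ s ∧ s < t}
    change _ = volume {s : ℝ | (shiftMap x, s) ∈ E ∧ 0 ≤ s ∧ s < t} +
      volume {s : ℝ | (x, s) ∈ E ∧ t ≤ s ∧ s < τ x}
    rw [← hA, ← hB, ← measure_union _ (measurable_add_const t (hslice x t (τ x)))]
    · congr 1
      ext s
      have := hc x
      simp only [coordFlow, Set.mem_ofPred_eq, Set.mem_union, Set.mem_preimage]
      have e : s + t - τ x = s + (t - τ x) := by ring
      split_ifs with h
      · constructor
        · rintro ⟨h1, h2, h3⟩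
          exact Or.inr ⟨h1, by linarith, h⟩
        · rintro (⟨-, h2, -⟩ | ⟨h1, h2, h3⟩)
          · linarith
          · exact ⟨h1, by linarith, by linarith⟩
      · rw [e]
        constructor
        · rintro ⟨h1, h2, h3⟩
          exact Or.inl ⟨h1, by linarith, by linarith⟩
        · rintro (⟨h1, h2, h3⟩ | ⟨-, -, h3⟩)
          · exact ⟨h1, by linarith, by linarith⟩
          · exact absurd h3 h
    · rw [Set.disjoint_left]
      rintro s ⟨-, h1, -⟩ ⟨-, -, h2⟩
      linarith
  simp only [e1, e2]
  have hlow' : Measurable fun x => low (shiftMap x) := hlow.comp continuous_shiftMap.measurable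
  rw [lintegral_add_left hlow', lintegral_add_left hlow,
    hμ.lintegral_comp hlow]

/-- Times at most `c` cross the roof at most once and are covered by `measurePreserving_coordFlow`;
an arbitrary time is a finite multiple of such a time, by the semi-flow property. -/
theorem invariant_lift {μ : Measure M.Shift} [SFinite μ]
    (hμ : MeasurePreserving shiftMap μ μ) : τ.Invariant (τ.lift μ) := by
  obtain ⟨c', hc', hle⟩ := τ.bounded_away
  obtain ⟨c, hc0, hcc⟩ := exists_between hc'
  have hc : ∀ x, c < τ x := fun x => hcc.trans_le (hle x)
  have small : ∀ t : ℝ≥0, (t : ℝ) ≤ c → MeasurePreserving (τ.flow t) (τ.lift μ) (τ.lift μ) := by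
    intro t ht
    have hm := τ.measurable_flow_of_le hc ht
    refine ⟨hm, ?_⟩
    have hcoord : (τ.lift μ).map (τ.coord ∘ τ.flow t) = τ.graphMeasure μ := by
      have : τ.coord ∘ τ.flow t = τ.coordFlow t ∘ τ.coord :=
        funext fun y => τ.coord_flow_eq_coordFlow hc ht y
      rw [this, ← Measure.map_map (τ.measurable_coordFlow t) τ.measurable_coord, τ.map_coord_lift,
        (τ.measurePreserving_coordFlow hμ hc t.coe_nonneg ht).map_eq]
    rw [← τ.map_clampPoint_map_coord ((τ.lift μ).map (τ.flow t)),
      Measure.map_map τ.measurable_coord hm, hcoord, lift]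
  intro t
  obtain ⟨n, hn⟩ := exists_nat_gt ((t : ℝ) / c)
  have hn0 : (0 : ℝ) < n := (div_nonneg t.coe_nonneg hc0.le).trans_lt hn
  have hiter : ∀ (s : ℝ≥0) (k : ℕ), τ.flow ((k + 1) * s) = (τ.flow s)^[k + 1] := by
    intro s k
    induction k with
    | zero => simp
    | succ k ih =>
      funext y
      rw [Function.iterate_succ_apply', ← ih, ← τ.flow_add]
      congr 1
      push_cast
      ring
  obtain ⟨k, rfl⟩ : ∃ k, n = k + 1 := ⟨n - 1, by
    have : 0 < n := by exact_mod_cast hn0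
    omega⟩
  have hs : ((t / ((k : ℝ≥0) + 1) : ℝ≥0) : ℝ) ≤ c := by
    push_cast at hn hn0 ⊢
    rw [div_le_iff₀ hn0]
    rw [div_lt_iff₀ hc0] at hn
    linarith
  have h := (small _ hs).iterate (k + 1)
  rw [← hiter, mul_div_cancel₀] at h
  · exact h
  · positivity

/-! ### Product structure of invariant measures. -/

theorem ae_mem_region (ν : Measure τ.Space) : ∀ᵐ p ∂(ν.map τ.coord), p ∈ τ.region :=
  (ae_map_iff τ.measurable_coord.aemeasurable τ.measurableSet_region).2
    (ae_of_all _ τ.coord_mem_region)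

open Classical in
/-- Vertical translations preserve the coordinate image of an invariant measure, as long as they
stay below the graph of `τ`. -/
theorem lintegral_translate {ν : Measure τ.Space} (hν : τ.Invariant ν) {t : ℝ} (ht : 0 ≤ t)
    {f : M.Shift × ℝ → ℝ≥0∞} (hf : Measurable f) :
    ∫⁻ p, (if t ≤ p.2 then f p else 0) ∂(ν.map τ.coord) =
      ∫⁻ p, (if p.2 + t < τ p.1 then f (p.1, p.2 + t) else 0) ∂(ν.map τ.coord) := by
  have h2 : Measurable fun p : M.Shift × ℝ => p.2 + t := measurable_snd.add_const t
  have hF : Measurable fun p : M.Shift × ℝ => if t ≤ p.2 then f p else 0 :=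
    Measurable.ite (measurableSet_le measurable_const measurable_snd) hf measurable_const
  have hG : Measurable fun p : M.Shift × ℝ =>
      if p.2 + t < τ p.1 then f (p.1, p.2 + t) else 0 :=
    Measurable.ite (measurableSet_lt h2 (τ.measurable_toFun.comp measurable_fst))
      (hf.comp (measurable_fst.prodMk h2)) measurable_const
  rw [lintegral_map hF τ.measurable_coord, lintegral_map hG τ.measurable_coord]
  refine ((hν ⟨t, ht⟩).lintegral_comp (hF.comp τ.measurable_coord)).symm.trans
    (lintegral_congr fun y => ?_)
  -- A point that stays below the roof ends at height at least `t`; one that crosses ends below `t`,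
  -- where the left integrand vanishes.
  by_cases h : (τ.coord y).2 + t < τ (τ.coord y).1
  · have e := τ.coord_flow_of_lt (t := ⟨t, ht⟩) h
    simp only [Function.comp_apply, e, if_pos h]
    exact if_pos (le_add_of_nonneg_left (τ.coord_mem_region y).1)
  · have e := τ.coord_flow_snd_lt_of_le (t := ⟨t, ht⟩) (not_lt.1 h)
    simp only [Function.comp_apply, if_neg h]
    exact if_neg (not_le.2 e)

open Classical in
/-- An invariant measure is, in coordinates, a product with Lebesgue measure. -/
theorem lintegral_map_coord {ν : Measure τ.Space} [SFinite ν] (hν : τ.Invariant ν) {c : ℝ}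
    (hc : ∀ x, c < τ x) {f : M.Shift × ℝ → ℝ≥0∞} (hf : Measurable f) :
    ENNReal.ofReal c * ∫⁻ p, f p ∂(ν.map τ.coord) =
      ∫⁻ p, (if p.2 < c then
        ∫⁻ v, (if 0 ≤ v ∧ v < τ p.1 then f (p.1, v) else 0) else 0) ∂(ν.map τ.coord) := by
  set m := ν.map τ.coord with hm
  -- Fubini in an auxiliary shift `r`. The kernel `k` sees `f` on the window of heights `[r, r +
  -- c)`; translating the window to `[0, c)` turns it into `l`. Integrating over `r` gives `c · f`
  -- for `k`, and the full fibre integral of `f` for `l`.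
  set k : M.Shift × ℝ → ℝ → ℝ≥0∞ := fun p r => if r ≤ p.2 ∧ p.2 < r + c then f p else 0 with hk
  set l : M.Shift × ℝ → ℝ → ℝ≥0∞ := fun p r =>
    if p.2 < c ∧ 0 ≤ p.2 + r ∧ p.2 + r < τ p.1 then f (p.1, p.2 + r) else 0 with hl
  have hx : Measurable fun q : (M.Shift × ℝ) × ℝ => q.1.1 := measurable_fst.comp measurable_fst
  have hs : Measurable fun q : (M.Shift × ℝ) × ℝ => q.1.2 := measurable_snd.comp measurable_fst
  have hr : Measurable fun q : (M.Shift × ℝ) × ℝ => q.2 := measurable_snd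
  have hkm : Measurable (Function.uncurry k) :=
    Measurable.ite ((measurableSet_le hr hs).inter (measurableSet_lt hs (hr.add_const c)))
      (hf.comp measurable_fst) measurable_const
  have hlm : Measurable (Function.uncurry l) :=
    Measurable.ite ((measurableSet_lt hs measurable_const).inter
      ((measurableSet_le measurable_const (hs.add hr)).inter
        (measurableSet_lt (hs.add hr) (τ.measurable_toFun.comp hx))))
      (hf.comp (hx.prodMk (hs.add hr))) measurable_const
  have step1 : ∀ p, ∫⁻ r, k p r = ENNReal.ofReal c * f p := fun p => by
    have : k p = (Set.Ioc (p.2 - c) p.2).indicator fun _ => f p := by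
      funext r
      simp only [hk, Set.indicator_apply, Set.mem_Ioc]
      congr 1
      exact propext ⟨fun h => ⟨by linarith [h.2], h.1⟩, fun h => ⟨h.2, by linarith [h.1]⟩⟩
    rw [this, lintegral_indicator_const measurableSet_Ioc, Real.volume_Ioc, sub_sub_cancel,
      mul_comm]
  have step2 : ∀ r, ∫⁻ p, k p r ∂m = ∫⁻ p, l p r ∂m := fun r => by
    rcases le_total 0 r with h0 | h0
    · have hf' : Measurable fun p : M.Shift × ℝ => if p.2 < r + c then f p else 0 :=
        Measurable.ite (measurableSet_lt measurable_snd measurable_const) hf measurable_const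
      have h := τ.lintegral_translate hν h0 hf'
      have e1 : ∀ p, k p r = if r ≤ p.2 then (if p.2 < r + c then f p else 0) else 0 := fun p => by
        simp only [hk]; grind
      simp only [e1]
      rw [h]
      refine lintegral_congr_ae ?_
      filter_upwards [τ.ae_mem_region ν] with p hp
      have := hp.1
      simp only [hl]
      grind
    -- For negative `r`, the translation by `-r` is read backwards. The constraint that it stay
    -- below the roof is automatic, since it ends at a height below `c < τ`.
    · have ht : 0 ≤ -r := by linarith
      have hf' : Measurable fun p : M.Shift × ℝ => if p.2 < c then f (p.1, p.2 + r) else 0 :=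
        Measurable.ite (measurableSet_lt measurable_snd measurable_const)
          (hf.comp (measurable_fst.prodMk (measurable_snd.add_const r))) measurable_const
      have h := τ.lintegral_translate hν ht hf'
      refine Eq.trans (lintegral_congr_ae ?_) (h.symm.trans (lintegral_congr_ae ?_))
      · filter_upwards [τ.ae_mem_region ν] with p hp
        have h1 := hp.1
        have h2 := hc p.1
        simp only [hk, neg_add_cancel_right]
        grind
      · filter_upwards [τ.ae_mem_region ν] with p hp
        have h1 := hp.1
        have h2 := hc p.1
        have h3 := hp.2
        simp only [hl]
        grind
  have step3 : ∀ p, ∫⁻ r, l p r = if p.2 < c then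
      ∫⁻ v, (if 0 ≤ v ∧ v < τ p.1 then f (p.1, v) else 0) else 0 := fun p => by
    split_ifs with h
    · refine Eq.trans ?_ (lintegral_add_left_eq_self
        (fun v => if 0 ≤ v ∧ v < τ p.1 then f (p.1, v) else 0) p.2)
      simp only [hl, h, true_and]
    · simp only [hl, h, false_and, if_false, lintegral_zero]
  rw [← lintegral_const_mul _ hf]
  simp only [← step1, ← step3]
  rw [lintegral_lintegral_swap hkm.aemeasurable, lintegral_lintegral_swap hlm.aemeasurable]
  exact lintegral_congr step2

/-- The measure on the base induced by a measure on `Y`, computed from heights below `c`. -/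
noncomputable def baseMeasure (c : ℝ) (ν : Measure τ.Space) : Measure M.Shift :=
  (ENNReal.ofReal c)⁻¹ • ((ν.map τ.coord).restrict {p | p.2 < c}).map Prod.fst

instance (c : ℝ) (ν : Measure τ.Space) [IsFiniteMeasure ν] : SFinite (τ.baseMeasure c ν) := by
  unfold baseMeasure; infer_instance

/-- This is `lintegral_map_coord` for the indicator of `E`: the inner integral is the length of the
slice of `E`, and the outer one is `c` times integration against `baseMeasure`. -/
theorem graphMeasure_baseMeasure {ν : Measure τ.Space} [IsFiniteMeasure ν] (hν : τ.Invariant ν)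
    {c : ℝ} (h0 : 0 < c) (hc : ∀ x, c < τ x) :
    τ.graphMeasure (τ.baseMeasure c ν) = ν.map τ.coord := by
  classical
  refine Measure.ext fun E hE => ?_
  have hs : MeasurableSet {p : M.Shift × ℝ | p.2 < c} :=
    measurableSet_lt measurable_snd measurable_const
  have hg : Measurable fun x => volume {s : ℝ | (x, s) ∈ E ∧ 0 ≤ s ∧ s < τ x} :=
    measurable_measure_prodMk_left (hE.inter τ.measurableSet_region)
  have h := τ.lintegral_map_coord hν hc (f := E.indicator 1) (measurable_one.indicator hE)
  rw [lintegral_indicator_one hE] at h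
  rw [τ.graphMeasure_apply _ hE, baseMeasure, lintegral_smul_measure,
    lintegral_map hg measurable_fst, ← lintegral_indicator hs, smul_eq_mul]
  have hne : ENNReal.ofReal c ≠ 0 := by simpa using h0
  rw [← ENNReal.mul_right_inj hne ENNReal.ofReal_ne_top, h, ← mul_assoc,
    ENNReal.mul_inv_cancel hne ENNReal.ofReal_ne_top, one_mul]
  refine lintegral_congr fun p => ?_
  rw [Set.indicator_apply]
  refine if_congr Iff.rfl ?_ rfl
  have hm : MeasurableSet {s : ℝ | (p.1, s) ∈ E ∧ 0 ≤ s ∧ s < τ p.1} :=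
    (measurable_prodMk_left hE).inter measurableSet_Ico
  rw [← lintegral_indicator_one hm]
  refine lintegral_congr fun v => ?_
  simp only [Set.indicator_apply, Set.mem_ofPred_eq, Pi.one_apply]
  grind

theorem lift_baseMeasure {ν : Measure τ.Space} [IsFiniteMeasure ν] (hν : τ.Invariant ν)
    {c : ℝ} (h0 : 0 < c) (hc : ∀ x, c < τ x) : τ.lift (τ.baseMeasure c ν) = ν := by
  rw [lift, τ.graphMeasure_baseMeasure hν h0 hc, τ.map_clampPoint_map_coord]

/-- A base measure whose lift is invariant is itself invariant under the shift. -/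
theorem measurePreserving_of_invariant_lift {μ : Measure M.Shift} [SFinite μ]
    (hμ : τ.Invariant (τ.lift μ)) {c : ℝ} (h0 : 0 < c) (hc : ∀ x, c < τ x) :
    MeasurePreserving shiftMap μ μ := by
  have hσ : Measurable (shiftMap : M.Shift → M.Shift) := continuous_shiftMap.measurable
  refine ⟨hσ, Measure.ext fun A hA => ?_⟩
  rw [Measure.map_apply hσ hA]
  -- Compare the mass of `A × [0,c)` with that of its preimage under the flow at time exactly `c`.
  set t : ℝ≥0 := ⟨c, h0.le⟩ with ht
  have hE : MeasurableSet (A ×ˢ Set.Iio c) := hA.prod measurableSet_Iio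
  have key : τ.graphMeasure μ (τ.coordFlow c ⁻¹' (A ×ˢ Set.Iio c)) =
      τ.graphMeasure μ (A ×ˢ Set.Iio c) := by
    rw [← τ.map_coord_lift μ, Measure.map_apply τ.measurable_coord hE,
      Measure.map_apply τ.measurable_coord (τ.measurable_coordFlow c hE),
      ← (hμ t).measure_preimage (τ.measurable_coord hE).nullMeasurableSet]
    congr 1
    ext y
    simp only [Set.mem_preimage]
    rw [τ.coord_flow_eq_coordFlow hc (t := t) le_rfl]
    rfl
  have hne : ENNReal.ofReal c ≠ 0 := by simpa using h0
  have e1 : τ.graphMeasure μ (A ×ˢ Set.Iio c) = ENNReal.ofReal c * μ A := by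
    rw [τ.graphMeasure_apply μ hE, ← lintegral_indicator_const hA]
    refine lintegral_congr fun x => ?_
    have := hc x
    by_cases hx : x ∈ A
    · have : {s : ℝ | (x, s) ∈ A ×ˢ Set.Iio c ∧ 0 ≤ s ∧ s < τ x} = Set.Ico 0 c := by
        ext s
        simp only [Set.mem_prod, hx, true_and, Set.mem_Iio, Set.mem_ofPred_eq, Set.mem_Ico]
        grind
      rw [Set.indicator_of_mem hx, this, Real.volume_Ico, sub_zero]
    · rw [Set.indicator_of_notMem hx]
      simp [hx]
  have e2 : τ.graphMeasure μ (τ.coordFlow c ⁻¹' (A ×ˢ Set.Iio c)) =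
      ENNReal.ofReal c * μ (shiftMap ⁻¹' A) := by
    rw [τ.graphMeasure_apply μ (τ.measurable_coordFlow c hE), ← lintegral_indicator_const (hσ hA)]
    refine lintegral_congr fun x => ?_
    have := hc x
    -- A point that does not cross ends at height at least `c`. Hence only the top strip of length
    -- `c` over `σ⁻¹A` lands in `A × [0,c)`.
    have e : {s : ℝ | (x, s) ∈ τ.coordFlow c ⁻¹' (A ×ˢ Set.Iio c) ∧ 0 ≤ s ∧ s < τ x} =
        {s : ℝ | shiftMap x ∈ A ∧ s ∈ Set.Ico (τ x - c) (τ x)} := by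
      ext s
      simp only [coordFlow, Set.mem_preimage, Set.mem_ofPred_eq, Set.mem_Ico]
      split_ifs with h
      · simp only [Set.mem_prod, Set.mem_Iio]
        grind
      · simp only [Set.mem_prod, Set.mem_Iio]
        grind
    by_cases hx : shiftMap x ∈ A
    · rw [Set.indicator_of_mem (by exact hx), e]
      simp only [hx, true_and, Set.ofPred_mem_eq]
      rw [Real.volume_Ico, sub_sub_cancel]
    · rw [Set.indicator_of_notMem (by exact hx), e]
      simp [hx]
  rw [e1, e2] at key
  exact (ENNReal.mul_right_inj hne ENNReal.ofReal_ne_top).1 key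

/-! ### Compactness of the space of base measures. -/

/-- The shift-invariant finite measures on the base for which `τ` has integral at most `1`. -/
def baseInvariant : Set (FiniteMeasure M.Shift) :=
  {μ | MeasurePreserving shiftMap (μ : Measure M.Shift) μ ∧
    ∫⁻ x, ENNReal.ofReal (τ x) ∂(μ : Measure M.Shift) ≤ 1}

/-- The bounded function `min τ N`. -/
noncomputable def truncation (N : ℕ) : BoundedContinuousFunction M.Shift ℝ≥0 :=
  BoundedContinuousFunction.mkOfBound
    ⟨fun x => min (τ x).toNNReal N,
      (continuous_real_toNNReal.comp τ.continuous_toFun).min continuous_const⟩ N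
    (fun x y => by
      have h (z : M.Shift) : ((min (τ z).toNNReal N : ℝ≥0) : ℝ) ≤ N := by
        exact_mod_cast min_le_right _ _
      rw [NNReal.dist_eq, abs_le]
      simp only [ContinuousMap.coe_mk]
      constructor <;> linarith [h x, h y, (min (τ x).toNNReal (N : ℝ≥0)).coe_nonneg,
        (min (τ y).toNNReal (N : ℝ≥0)).coe_nonneg])

theorem lintegral_le_iff_truncation (μ : Measure M.Shift) (R : ℝ≥0∞) :
    ∫⁻ x, ENNReal.ofReal (τ x) ∂μ ≤ R ↔ ∀ N, ∫⁻ x, τ.truncation N x ∂μ ≤ R := by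
  have e : ∀ x, ENNReal.ofReal (τ x) = ⨆ N : ℕ, (τ.truncation N x : ℝ≥0∞) := by
    intro x
    apply le_antisymm
    · obtain ⟨N, hN⟩ := exists_nat_ge (τ x).toNNReal
      refine le_iSup_of_le N ?_
      change ((τ x).toNNReal : ℝ≥0∞) ≤ ((min (τ x).toNNReal N : ℝ≥0) : ℝ≥0∞)
      rw [min_eq_left hN]
    · exact iSup_le fun N => ENNReal.coe_le_coe.2 (min_le_left _ _)
  simp only [e]
  rw [lintegral_iSup (fun N => (τ.truncation N).continuous.measurable.coe_nnreal_ennreal), iSup_le_iff]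
  intro N N' h x
  exact ENNReal.coe_le_coe.2 (min_le_min_left _ (by exact_mod_cast h))

/-- Push-forward by the continuous shift is weakly continuous, so its fixed points form a closed
set. The bound on `∫ τ` is equivalent, by monotone convergence, to bounds on all the bounded
continuous truncations, each a closed condition. -/
theorem isClosed_baseInvariant : IsClosed τ.baseInvariant := by
  have e : τ.baseInvariant = {μ : FiniteMeasure M.Shift | μ.map shiftMap = μ} ∩
      ⋂ N : ℕ, {μ : FiniteMeasure M.Shift |
        ∫⁻ x, τ.truncation N x ∂(μ : Measure M.Shift) ≤ 1} := by
    ext μ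
    simp only [baseInvariant, Set.mem_ofPred_eq, Set.mem_inter_iff, Set.mem_iInter,
      τ.lintegral_le_iff_truncation]
    refine and_congr_left fun _ => ⟨fun h => ?_, fun h => ⟨continuous_shiftMap.measurable, ?_⟩⟩
    · exact FiniteMeasure.toMeasure_injective h.map_eq
    · exact congrArg FiniteMeasure.toMeasure h
  rw [e]
  refine (isClosed_eq (FiniteMeasure.continuous_map continuous_shiftMap) continuous_id).inter
    (isClosed_iInter fun N => isClosed_le ?_ continuous_const)
  exact FiniteMeasure.continuous_lintegral_boundedContinuousFunction _

theorem exists_forall_le_of_le_val_zero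
    (h : Tendsto (fun k : ℕ => ⨅ x : {x : M.Shift // k ≤ x.val 0}, τ x) atTop atTop) (R : ℝ) :
    ∃ k : ℕ, ∀ x : M.Shift, k ≤ x.val 0 → R ≤ τ x := by
  obtain ⟨k, hk⟩ := (h.eventually_ge_atTop R).exists
  refine ⟨k, fun x hx => hk.trans (ciInf_le ⟨0, ?_⟩ (⟨x, hx⟩ : {x : M.Shift // k ≤ x.val 0}))⟩
  rintro _ ⟨y, rfl⟩
  exact (τ.pos y).le

/-- Tightness by Markov and invariance: `μ{x_j ≥ κ m} = μ{x_0 ≥ κ m} ≤ μ{τ ≥ 2^m} ≤ 2^{-m}`. Summing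
over the coordinates leaves little mass outside a product of finite sets of symbols. -/
theorem isCompact_baseInvariant
    (h : Tendsto (fun k : ℕ => ⨅ x : {x : M.Shift // k ≤ x.val 0}, τ x) atTop atTop) :
    IsCompact τ.baseInvariant := by
  obtain ⟨c, h0, hc⟩ := τ.bounded_away
  choose κ hκ using fun m : ℕ => τ.exists_forall_le_of_le_val_zero h ((2 : ℝ) ^ m)
  -- The threshold index `n + (j + 1)` allots mass `2^{-(n+j+1)}` to coordinate `j`; these sum over
  -- `j` to exactly `2^{-n}`.
  set K : ℕ → Set M.Shift := fun n => {x | ∀ j, x.val j < κ (n + (j + 1))} with hK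
  have hKc : ∀ n, IsCompact (K n) := fun n => isCompact_setOf_val_lt _
  have hu : Tendsto (fun n : ℕ => (2⁻¹ : ℝ≥0) ^ n) atTop (𝓝 0) :=
    NNReal.tendsto_pow_atTop_nhds_zero_of_lt_one (inv_lt_one_of_one_lt₀ one_lt_two)
  refine (isCompact_setOfPred_finiteMeasure_mass_le_compl_isCompact_le (E := M.Shift)
    (c.toNNReal)⁻¹ hu hKc (Or.inl inferInstance)).of_isClosed_subset τ.isClosed_baseInvariant ?_
  rintro μ ⟨hμ, hint⟩
  have hτ : Measurable fun x => ENNReal.ofReal (τ x) := τ.measurable_toFun.ennreal_ofReal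
  have markov : ∀ r : ℝ, 0 < r →
      (μ : Measure M.Shift) {x | r ≤ τ x} ≤ (ENNReal.ofReal r)⁻¹ := fun r hr => by
    have h1 := (mul_meas_ge_le_lintegral (μ := (μ : Measure M.Shift)) hτ
      (ENNReal.ofReal r)).trans hint
    rw [mul_comm, ← ENNReal.le_div_iff_mul_le (by simp [hr]) (by simp), one_div] at h1
    refine le_trans (measure_mono fun x hx => ?_) h1
    exact ENNReal.ofReal_le_ofReal hx
  constructor
  · rw [← ENNReal.coe_le_coe, FiniteMeasure.ennreal_mass,
      ENNReal.coe_inv (by simpa using h0)]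
    exact le_trans (measure_mono fun x _ => hc x) (markov c h0)
  · intro n
    rw [← ENNReal.coe_le_coe, FiniteMeasure.ennreal_coeFn_eq_coeFn_toMeasure]
    have hsub : (K n)ᶜ ⊆ ⋃ j : ℕ, shiftMap^[j] ⁻¹' {x : M.Shift | κ (n + (j + 1)) ≤ x.val 0} := by
      intro x hx
      simp only [hK, Set.mem_compl_iff, Set.mem_ofPred_eq, not_forall, not_lt] at hx
      obtain ⟨j, hj⟩ := hx
      refine Set.mem_iUnion.2 ⟨j, ?_⟩
      simpa [shiftMap_iterate_val] using hj
    have hj : ∀ j : ℕ, (μ : Measure M.Shift)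
        (shiftMap^[j] ⁻¹' {x : M.Shift | κ (n + (j + 1)) ≤ x.val 0}) ≤ 2⁻¹ ^ (n + (j + 1)) := by
      intro j
      have hm : MeasurableSet {x : M.Shift | κ (n + (j + 1)) ≤ x.val 0} :=
        measurableSet_le measurable_const (continuous_coordinate 0).measurable
      rw [(hμ.iterate j).measure_preimage hm.nullMeasurableSet]
      refine le_trans (measure_mono (hκ (n + (j + 1)))) ((markov _ (by positivity)).trans_eq ?_)
      rw [ENNReal.ofReal_pow (by norm_num), ENNReal.inv_pow]
      norm_num
    calc (μ : Measure M.Shift) (K n)ᶜ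
        ≤ ∑' j : ℕ, (μ : Measure M.Shift)
            (shiftMap^[j] ⁻¹' {x : M.Shift | κ (n + (j + 1)) ≤ x.val 0}) :=
          (measure_mono hsub).trans (measure_iUnion_le _)
      _ ≤ ∑' j : ℕ, (2⁻¹ : ℝ≥0∞) ^ (n + (j + 1)) := ENNReal.tsum_le_tsum hj
      _ = 2⁻¹ ^ n := by
        simp only [pow_add _ n]
        rw [ENNReal.tsum_mul_left, ENNReal.tsum_geometric_add_one, ENNReal.one_sub_inv_two,
          inv_inv, ENNReal.inv_mul_cancel (by norm_num) (by norm_num), mul_one]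
      _ = (((2⁻¹ : ℝ≥0) ^ n : ℝ≥0) : ℝ≥0∞) := by
        rw [ENNReal.coe_pow, ENNReal.coe_inv (by norm_num)]
        norm_num

/-- The indicator of a clopen set is a bounded continuous test function. -/
theorem continuous_measure_isClopen {C : Set M.Shift} (hC : IsClopen C) :
    Continuous fun μ : FiniteMeasure M.Shift => (μ : Measure M.Shift) C := by
  set f : BoundedContinuousFunction M.Shift ℝ≥0 := BoundedContinuousFunction.mkOfBound
    ⟨C.indicator 1, hC.continuous_indicator continuous_one⟩ 1 (fun x y => by
      by_cases hx : x ∈ C <;> by_cases hy : y ∈ C <;> simp [hx, hy, NNReal.dist_eq])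
  have h := FiniteMeasure.continuous_lintegral_boundedContinuousFunction f
  refine h.congr fun μ => ?_
  rw [← lintegral_indicator_one hC.isOpen.measurableSet]
  refine lintegral_congr fun x => ?_
  change ((C.indicator 1 x : ℝ≥0) : ℝ≥0∞) = _
  by_cases hx : x ∈ C <;> simp [hx]

/-! ### Extraction of subsequences. -/

/-- The evaluation of measures on all cylinders. -/
noncomputable def cylinderValues (μ : FiniteMeasure M.Shift) (w : Σ n : ℕ, Fin (n + 1) → ℕ) :
    ℝ≥0∞ :=
  (μ : Measure M.Shift) (M.cylinder w.2)

theorem exists_subseq_tendsto_cylinder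
    (h : Tendsto (fun k : ℕ => ⨅ x : {x : M.Shift // k ≤ x.val 0}, τ x) atTop atTop)
    {μ : ℕ → FiniteMeasure M.Shift} (hμ : ∀ n, μ n ∈ τ.baseInvariant) :
    ∃ μ' ∈ τ.baseInvariant, ∃ φ : ℕ → ℕ, StrictMono φ ∧ ∀ (n : ℕ) (a : Fin (n + 1) → ℕ),
      Tendsto (fun k => (μ (φ k) : Measure M.Shift) (M.cylinder a)) atTop
        (𝓝 ((μ' : Measure M.Shift) (M.cylinder a))) := by
  have hcont : Continuous (cylinderValues (M := M)) :=
    continuous_pi fun w => continuous_measure_isClopen (isClopen_cylinder w.2)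
  -- The subsequence is taken in the image in a countable product of copies of `ℝ≥0∞`, which is
  -- first countable, so compactness there yields sequential compactness without metrizing the weak
  -- topology.
  obtain ⟨_, ⟨μ', hμ', rfl⟩, φ, hφ, hlim⟩ :=
    ((τ.isCompact_baseInvariant h).image hcont).tendsto_subseq
      (x := fun n => cylinderValues (μ n)) fun n => ⟨μ n, hμ n, rfl⟩
  refine ⟨μ', hμ', φ, hφ, fun n a => ?_⟩
  exact (tendsto_pi_nhds.1 hlim) ⟨n, a⟩

theorem exists_baseInvariant_lift_eq {c : ℝ} (h0 : 0 < c) (hc : ∀ x, c < τ x)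
    {ν : Measure τ.Space} (hν : ν Set.univ ≤ 1) (hinv : τ.Invariant ν) :
    ∃ μ ∈ τ.baseInvariant, τ.lift (μ : Measure M.Shift) = ν := by
  have : IsFiniteMeasure ν := ⟨hν.trans_lt ENNReal.one_lt_top⟩
  have hl := τ.lift_baseMeasure hinv h0 hc
  have hint : ∫⁻ x, ENNReal.ofReal (τ x) ∂(τ.baseMeasure c ν) ≤ 1 := by
    rw [← τ.lift_univ, hl]; exact hν
  -- Finiteness comes from `c · μ(Σ) ≤ ∫ τ dμ = ν(Y) ≤ 1`.
  have hfin : IsFiniteMeasure (τ.baseMeasure c ν) := by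
    refine ⟨lt_of_le_of_ne le_top fun htop => ?_⟩
    have h1 : ENNReal.ofReal c * τ.baseMeasure c ν Set.univ ≤ 1 := by
      rw [← lintegral_const]
      exact (lintegral_mono fun x => ENNReal.ofReal_le_ofReal (hc x).le).trans hint
    rw [htop, ENNReal.mul_top (by simpa using h0)] at h1
    simp at h1
  have hpres := τ.measurePreserving_of_invariant_lift (μ := τ.baseMeasure c ν)
    (hl.symm ▸ hinv) h0 hc
  exact ⟨⟨τ.baseMeasure c ν, hfin⟩, ⟨hpres, hint⟩, hl⟩

theorem exists_subseq_convergesOnCylinders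
    (h : Tendsto (fun k : ℕ => ⨅ x : {x : M.Shift // k ≤ x.val 0}, τ x) atTop atTop)
    {c : ℝ} (h0 : 0 < c) (hc : ∀ x, c < τ x) (ν : ℕ → τ.SubProb) :
    ∃ (ν' : τ.SubProb) (φ : ℕ → ℕ), StrictMono φ ∧
      τ.ConvergesOnCylinders c (fun k => (ν (φ k)).1) ν'.1 := by
  choose μ hμ hlift using fun n => τ.exists_baseInvariant_lift_eq h0 hc (ν n).2.1 (ν n).2.2
  obtain ⟨μ', hμ', φ, hφ, hlim⟩ := τ.exists_subseq_tendsto_cylinder h hμ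
  refine ⟨⟨τ.lift (μ' : Measure M.Shift), ?_, τ.invariant_lift hμ'.1⟩, φ, hφ, fun n a => ?_⟩
  · rw [τ.lift_univ]; exact hμ'.2
  · have hC := (isClopen_cylinder (M := M) a).isOpen.measurableSet
    simp only [← hlift, τ.lift_box _ hc hC]
    exact ENNReal.Tendsto.const_mul (hlim n a) (Or.inr ENNReal.ofReal_ne_top)

end RoofFunction

theorem mainTheorem9 (M : CountableMarkovShift) (τ : RoofFunction M)
    (hτ : CountableMarkovShift.ClassR (M := M) τ)
    (c : ℝ) (hc : 0 < c) (hcτ : c < ⨅ x, τ x) :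
    (∀ ν : ℕ → Measure τ.Space,
        (∀ n, IsProbabilityMeasure (ν n) ∧ τ.Invariant (ν n)) →
        ∃ (φ : ℕ → ℕ) (ν' : Measure τ.Space), StrictMono φ ∧
          ν' Set.univ ≤ 1 ∧ τ.Invariant ν' ∧
          τ.ConvergesOnCylinders c (fun k => ν (φ k)) ν') ∧
      @SeqCompactSpace τ.SubProb (τ.cylinderTopology c) := by
  have hlt : ∀ x, c < τ x := fun x => hcτ.trans_le
    (ciInf_le ⟨0, by rintro _ ⟨y, rfl⟩; exact (τ.pos y).le⟩ x)
  constructor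
  · intro ν hν
    obtain ⟨ν', φ, hφ, hlim⟩ := τ.exists_subseq_convergesOnCylinders hτ.tendsto_iInf hc hlt
      fun n => ⟨ν n, (hν n).1.measure_univ.le, (hν n).2⟩
    exact ⟨φ, ν'.1, hφ, ν'.2.1, ν'.2.2, hlim⟩
  · let := τ.cylinderTopology c
    refine ⟨fun ν _ => ?_⟩
    obtain ⟨ν', φ, hφ, hlim⟩ := τ.exists_subseq_convergesOnCylinders hτ.tendsto_iInf hc hlt ν
    exact ⟨ν', Set.mem_univ _, φ, hφ, (τ.tendsto_cylinderTopology_iff c _ _).2 hlim⟩
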